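/- Let $(J_i)_{i\in A}$ be a finite or countable family of pairwise disjoint intervals $J_i\subset[0,1)$ (each may or may not contain its endpoints) with $\sum_i|J_i|=1$, and let $f:\bigcup_i J_i\to[0,1)$ be such that for every $i$ the restriction $f|_{J_i}$ is monotone (increasing or decreasing), satisfies $(0,1)\subset f(J_i)$, and satisfies $|f(y)-f(z)|\ge|y-z|$ for all $y,z\in J_i$. (This contains the case of half-open intervals $J_i=[a_i,b_i)$ with $f(J_i)=[0,1)$, and the map $x\mapsto 1/x \bmod 1$.) For $\omega=(\omega_1,\omega_2,\dots)\in A^{\mathbb N}$ and $n\ge 0$ let $$C_{\omega_1\dots\omega_n}=\{y\in[0,1): f^{i-1}(y)\in J_{\omega_i}\text{ for } 1\le i\le n\}$$ be the cylinder of generation $n$; it is an interval of length $|C_{\omega_1\dots\omega_n}|$. A point $y\in[0,1)$ has a well-defined expansion if $f^n(y)$ is defined and lies in $\bigcup_iJ_i$ for every $n\ge0$. For $\alpha,\beta\in(0,1)$ the $(\alpha,\beta)$-game is played as follows. Black chooses a nondegenerate closed interval $B_0\subset[0,1]$; for each $k\ge0$ White chooses a closed interval $W_k\subset B_k$ with $|W_k|=\alpha|B_k|$,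 and then Black chooses a closed interval $B_{k+1}\subset W_k$ with $|B_{k+1}|=\beta|W_k|$. A set $E$ is $(\alpha,\beta)$-winning in $[0,1]$ if White has a strategy which guarantees $\bigcap_kW_k\subset E$, and $\alpha$-winning if it is $(\alpha,\beta)$-winning for all $\beta\in(0,1)$. Assume: (i) $\alpha_0\in(0,1)$ is such that for every $k\in\mathbb N$, every nondegenerate closed interval $I\subset[0,1)$ and every $\beta\in(0,1)$, White has a strategy in the $(\alpha_0,\beta)$-game started with $B_0=I$ which guarantees that, after finitely many turns, one of his intervals $W_j$ is contained in a cylinder of generation $k$; (ii) there is a function $g:\mathbb N\to(0,\infty)$ with $g(m)\to0$ as $m\to\infty$ such that $$\frac{|C_{\omega_1\dots\omega_{n+m}}|}{|C_{\omega_1\dots\omega_n}|}\le g(m)\qquad\text{for all }\omega\in A^{\mathbb N}\text{ and all } n,m\ge1 .$$ Let $x\in[0,1)$ have a well-defined expansion and suppose that for no $n$ is $x$ an accumulation point of the set of endpoints of generation-$n$ cylinders. (This last condition holds automatically if there are finitely many branches, or if $x$ is not an endpoint of any cylinder.) Then the set $$G_f(x)=\Big\{y\in[0,1): y\text{ has a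 well-defined expansion and } x\notin\overline{\textstyle\bigcup_{n\ge0}\{f^n(y)\}}\Big\}$$ is $\alpha$-winning in $[0,1]$ for $\alpha=\min\{\alpha_0,\tfrac14\}$. -/

import Mathlib

open Set Filter Topology MeasureTheory

/-- A nondegenerate compact interval `[left, right]`. -/
structure ClosedInterval where
  left : ℝ
  right : ℝ
  left_lt_right : left < right

namespace ClosedInterval

def toSet (I : ClosedInterval) : Set ℝ := Icc I.left I.right

def length (I : ClosedInterval) : ℝ := I.right - I.left

end ClosedInterval

/-- A strategy for White: given Black's moves `B 0, …, B n`, it returns White's move `W n`.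
(White's own earlier moves are determined by the strategy and Black's moves.) -/
abbrev WhiteStrategy : Type := (n : ℕ) → (Fin (n + 1) → ClosedInterval) → ClosedInterval

/-- The `n`-th move of White when he follows `σ` and Black plays the sequence `B`. -/
def WhiteStrategy.move (σ : WhiteStrategy) (B : ℕ → ClosedInterval) (n : ℕ) : ClosedInterval :=
  σ n (fun i => B i)

/-- All moves of Black after the initial one obey the rules of the game with parameter `β`. -/
def BlackLegal (β : ℝ) (σ : WhiteStrategy) (B : ℕ → ClosedInterval) : Prop :=
  ∀ n, (B (n + 1)).toSet ⊆ (σ.move B n).toSet ∧ (B (n + 1)).length = β * (σ.move B n).length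

/-- All moves of White obey the rules of the game with parameter `α`. -/
def WhiteLegal (α : ℝ) (σ : WhiteStrategy) (B : ℕ → ClosedInterval) : Prop :=
  ∀ n, (σ.move B n).toSet ⊆ (B n).toSet ∧ (σ.move B n).length = α * (B n).length

/-- `E` is `(α, β)`-winning in `[0,1]`: White has a strategy that is legal and forces the
intersection of his intervals into `E`, whatever legal moves Black makes. -/
def IsAlphaBetaWinning (α β : ℝ) (E : Set ℝ) : Prop :=
  ∃ σ : WhiteStrategy, ∀ B : ℕ → ClosedInterval,
    (B 0).toSet ⊆ Icc 0 1 → BlackLegal β σ B →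
      WhiteLegal α σ B ∧ ⋂ n, (σ.move B n).toSet ⊆ E

/-- `E` is `α`-winning in `[0,1]`. -/
def IsAlphaWinning (α : ℝ) (E : Set ℝ) : Prop :=
  ∀ β : ℝ, 0 < β → β < 1 → IsAlphaBetaWinning α β E

/-- `f` is a piecewise monotone, non-contracting map with full branches on the intervals `J i`.
Only the values of `f` on the intervals `J i` matter. The `J i` may or may not contain their
endpoints, and accordingly the image of a branch is `[0,1)` or `(0,1)`. In particular
half-open intervals `[a,b)` mapped onto `[0,1)` are allowed, and so is `x ↦ 1/x mod 1`. -/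
structure IsFullBranchMap {ι : Type*} (f : ℝ → ℝ) (J : ι → Set ℝ) : Prop where
  subset_unit : ∀ i, J i ⊆ Ico 0 1
  interval : ∀ i, (J i).OrdConnected
  disjoint : Pairwise (fun i j => Disjoint (J i) (J j))
  total_length : ∑' i, volume (J i) = 1
  monotone_or_antitone : ∀ i, MonotoneOn f (J i) ∨ AntitoneOn f (J i)
  mapsTo : ∀ i, MapsTo f (J i) (Ico 0 1)
  onto : ∀ i, Ioo 0 1 ⊆ f '' J i
  noncontracting : ∀ i, ∀ x ∈ J i, ∀ y ∈ J i, |x - y| ≤ |f x - f y|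

/-- The generation-`n` cylinder given by the first `n` symbols of `ω`
(symbols are indexed from `0`). For `n = 0` it is `[0,1)`. -/
def cylinder {ι : Type*} (f : ℝ → ℝ) (J : ι → Set ℝ) (ω : ℕ → ι) (n : ℕ) : Set ℝ :=
  {x | x ∈ Ico (0 : ℝ) 1 ∧ ∀ i < n, f^[i] x ∈ J (ω i)}

/-- The endpoints of the generation-`n` cylinders (which are bounded intervals). -/
def cylinderEndpoints {ι : Type*} (f : ℝ → ℝ) (J : ι → Set ℝ) (n : ℕ) : Set ℝ :=
  ⋃ ω : ℕ → ι, frontier (cylinder f J ω n)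

/-- `x ∈ [0,1)` has a well-defined expansion: every iterate `f^n x` lies in a branch interval. -/
def HasExpansion {ι : Type*} (f : ℝ → ℝ) (J : ι → Set ℝ) (x : ℝ) : Prop :=
  x ∈ Ico (0 : ℝ) 1 ∧ ∀ n : ℕ, ∃ i, f^[n] x ∈ J i

/-- `G_f(x)`: the points whose forward orbit is defined for all times and whose orbit closure
misses `x`. -/
def orbitAvoidingSet {ι : Type*} (f : ℝ → ℝ) (J : ι → Set ℝ) (x : ℝ) : Set ℝ :=
  {y | HasExpansion f J y ∧ x ∉ closure (range fun n : ℕ => f^[n] y)}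

/-- Condition (i): for every generation `k`, every closed interval `I ⊂ [0,1)` and every `β`,
White can, in the `(α₀, β)`-game with `B 0 = I`, put one of his intervals inside a
generation-`k` cylinder after finitely many turns. -/
def CanEnterCylinders {ι : Type*} (f : ℝ → ℝ) (J : ι → Set ℝ) (α₀ : ℝ) : Prop :=
  ∀ (k : ℕ) (I : ClosedInterval), I.toSet ⊆ Ico 0 1 → ∀ β : ℝ, 0 < β → β < 1 →
    ∃ σ : WhiteStrategy, ∀ B : ℕ → ClosedInterval, B 0 = I → BlackLegal β σ B →
      WhiteLegal α₀ σ B ∧ ∃ j : ℕ, ∃ ω : ℕ → ι, (σ.move B j).toSet ⊆ cylinder f J ω k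

/-- Condition (ii): uniform relative shrinking of cylinders. -/
def CylindersShrink {ι : Type*} (f : ℝ → ℝ) (J : ι → Set ℝ) : Prop :=
  ∃ g : ℕ → ℝ, (∀ m, 0 < g m) ∧ Tendsto g atTop (𝓝 0) ∧
    ∀ (ω : ℕ → ι) (n m : ℕ), 1 ≤ n → 1 ≤ m →
      volume.real (cylinder f J ω (n + m)) / volume.real (cylinder f J ω n) ≤ g m

/-!
White keeps the orbit of the outcome away from `x` by avoiding, for every cylinder `C` of
generation `n`, the obstacle `{y ∈ C | f^n y ∈ U}`, where `U` is a small neighbourhood of `x`.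

*Obstacles are short.* Since endpoints of generation-`N` cylinders do not accumulate at `x`, and
since these cylinders are dense by the entry hypothesis, `U` can be chosen such that each of its
two sides lies in a single generation-`N` cylinder (`exists_sides_subset_cylinder`). As `f^n` is
injective and monotone on `C`, an obstacle is then an interval covered by two cylinders of
generation `n + N` inside `C` and one point, and condition (ii) makes it as short relative to `C` as desired
(`IsFullBranchMap.abs_sub_le_of_mem_obstacle`). No bound on distortion is needed, because an
obstacle is dealt with when Black's interval becomes as short as `C`, not when it becomes as short
as the obstacle itself.

*Few obstacles enter at a time.* Condition (ii) makes cylinder lengths decay exponentially in the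
generation, uniformly in the word. Hence the number of cylinders which meet an interval `B` and
have length between `|B|` and a constant multiple of `|B|` is bounded
(`IsFullBranchMap.exists_encard_gradedCylinder_le`).

*Avoiding them.* The obstacle of `C`, if it still meets Black's interval `B` and `|B| ≤ |C|`, is
given the weight `(|C| / |B|) ^ s`, with `s` such that weights grow by the factor `3 / 2` in each
turn. As `α ≤ 1/4`, a short obstacle cannot meet both the left and the right `α`-part of `B`, so the
better of these two choices at least halves the total weight. The total weight thus stays bounded,
whereas the weight of an obstacle containing the outcome would tend to infinity
(`winsFrom_compl_iUnion`).

*Expansions.* A point has a well-defined expansion if and only if it lies in cylinders of all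
generations, and entering generation `k` is possible for each `k` (`CanEnterCylinders.winsFrom`).
Nothing bounds the time this takes, but the avoidance game and the entry games for all `k` can be
interleaved by Schmidt's intersection principle (`isAlphaWinning_iInter`), which requires winning
strategies for every `β`.
-/

open ClosedInterval

/-! ### Intervals and strategies -/

namespace ClosedInterval

lemma length_pos (I : ClosedInterval) : 0 < I.length := sub_pos.2 I.left_lt_right

open Classical in
/-- The subinterval of `I` with the same left endpoint and length `t * I.length`.
It is meant for `0 < t ≤ 1`; for `t ≤ 0` it is `I` itself. -/
noncomputable def leftPart (t : ℝ) (I : ClosedInterval) : ClosedInterval :=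
  if h : 0 < t then
    ⟨I.left, I.left + t * I.length, by have := mul_pos h I.length_pos; linarith⟩
  else I

open Classical in
/-- The subinterval of `I` with the same right endpoint and length `t * I.length`.
It is meant for `0 < t ≤ 1`; for `t ≤ 0` it is `I` itself. -/
noncomputable def rightPart (t : ℝ) (I : ClosedInterval) : ClosedInterval :=
  if h : 0 < t then
    ⟨I.right - t * I.length, I.right, by have := mul_pos h I.length_pos; linarith⟩
  else I

lemma toSet_subset_iff (I K : ClosedInterval) :
    I.toSet ⊆ K.toSet ↔ K.left ≤ I.left ∧ I.right ≤ K.right :=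
  Icc_subset_Icc_iff I.left_lt_right.le

lemma length_leftPart {t : ℝ} (ht : 0 < t) (I : ClosedInterval) :
    (I.leftPart t).length = t * I.length := by
  simp [leftPart, ht, length]

lemma length_rightPart {t : ℝ} (ht : 0 < t) (I : ClosedInterval) :
    (I.rightPart t).length = t * I.length := by
  simp [rightPart, ht, length]

lemma leftPart_subset {t : ℝ} (ht : 0 < t) (ht1 : t ≤ 1) (I : ClosedInterval) :
    (I.leftPart t).toSet ⊆ I.toSet := by
  rw [toSet_subset_iff]
  have := mul_le_of_le_one_left I.length_pos.le ht1
  simp only [leftPart, ht, dif_pos, le_refl, true_and]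
  simp only [length] at *
  linarith

lemma rightPart_subset {t : ℝ} (ht : 0 < t) (ht1 : t ≤ 1) (I : ClosedInterval) :
    (I.rightPart t).toSet ⊆ I.toSet := by
  rw [toSet_subset_iff]
  have := mul_le_of_le_one_left I.length_pos.le ht1
  simp only [rightPart, ht, dif_pos, le_refl, and_true]
  simp only [length] at *
  linarith

end ClosedInterval

/-- `σ.move B n` depends only on the first `n + 1` moves of Black. -/
lemma WhiteStrategy.move_congr (σ : WhiteStrategy) {B B' : ℕ → ClosedInterval} {n : ℕ}
    (h : ∀ i ≤ n, B i = B' i) : σ.move B n = σ.move B' n := by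
  unfold WhiteStrategy.move
  congr 1
  funext i
  exact h i (Nat.lt_succ_iff.1 i.2)

/-- The play in which Black makes the moves `B 0, …, B n` and afterwards always answers White's
move with its left part of relative length `β`. The branch `B 0` in the recursion is never reached:
it only makes the decrease of the index visible. -/
noncomputable def continuedPlay (σ : WhiteStrategy) (β : ℝ) (B : ℕ → ClosedInterval) (n : ℕ) :
    ℕ → ClosedInterval
  | i => if i ≤ n then B i else
      (σ (i - 1) (fun j : Fin (i - 1 + 1) =>
        if _h : (j : ℕ) < i then continuedPlay σ β B n j else B 0)).leftPart β
  termination_by i => i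

lemma continuedPlay_of_le (σ : WhiteStrategy) (β : ℝ) (B : ℕ → ClosedInterval) {n i : ℕ}
    (h : i ≤ n) : continuedPlay σ β B n i = B i := by
  rw [continuedPlay, if_pos h]

lemma continuedPlay_succ (σ : WhiteStrategy) (β : ℝ) (B : ℕ → ClosedInterval) {n i : ℕ}
    (h : n ≤ i) :
    continuedPlay σ β B n (i + 1) = (σ.move (continuedPlay σ β B n) i).leftPart β := by
  rw [continuedPlay, if_neg (by omega)]
  unfold WhiteStrategy.move
  congr 2
  funext j
  have := j.2
  rw [dif_pos (by omega)]

/-- A legal beginning of a play can be continued legally by Black. -/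
lemma blackLegal_continuedPlay {σ : WhiteStrategy} {β : ℝ} (hβ : 0 < β) (hβ' : β < 1)
    {B : ℕ → ClosedInterval} {n : ℕ}
    (h : ∀ i < n, (B (i + 1)).toSet ⊆ (σ.move B i).toSet ∧
      (B (i + 1)).length = β * (σ.move B i).length) :
    BlackLegal β σ (continuedPlay σ β B n) := by
  intro i
  rcases lt_or_ge i n with hi | hi
  · rw [continuedPlay_of_le _ _ _ (Nat.succ_le_of_lt hi),
      σ.move_congr (B' := B) fun j hj => continuedPlay_of_le _ _ _ (hj.trans hi.le)]
    exact h i hi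
  · rw [continuedPlay_succ _ _ _ hi]
    exact ⟨leftPart_subset hβ hβ'.le _, length_leftPart hβ _⟩

/-- In the `(α, β)`-game started at `I`, White has a strategy which forces the outcome into `E`
and which is legal whatever Black does. -/
def WinsFrom (α β : ℝ) (I : ClosedInterval) (E : Set ℝ) : Prop :=
  ∃ σ : WhiteStrategy, (∀ B, WhiteLegal α σ B) ∧
    ∀ B : ℕ → ClosedInterval, B 0 = I → BlackLegal β σ B → ⋂ n, (σ.move B n).toSet ⊆ E

/-- A strategy which is legal and successful against legal play may be replaced by one that is
legal against arbitrary play: wherever it would break the rules, no legal play has led there. -/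
lemma winsFrom_of_legal {α β : ℝ} (hα : 0 < α) (hα' : α < 1) (hβ : 0 < β) (hβ' : β < 1)
    {I : ClosedInterval} {E : Set ℝ} {σ : WhiteStrategy}
    (h : ∀ B : ℕ → ClosedInterval, B 0 = I → BlackLegal β σ B →
      WhiteLegal α σ B ∧ ⋂ n, (σ.move B n).toSet ⊆ E) :
    WinsFrom α β I E := by
  classical
  let τ : WhiteStrategy := fun n h =>
    if (σ n h).toSet ⊆ (h (Fin.last n)).toSet ∧ (σ n h).length = α * (h (Fin.last n)).length
    then σ n h else (h (Fin.last n)).leftPart α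
  have hτ : ∀ B n, τ.move B n =
      if (σ.move B n).toSet ⊆ (B n).toSet ∧ (σ.move B n).length = α * (B n).length
      then σ.move B n else (B n).leftPart α := fun B n => rfl
  refine ⟨τ, fun B n => ?_, fun B hB0 hB => ?_⟩
  · rw [hτ]
    split_ifs with h1
    · exact h1
    · exact ⟨leftPart_subset hα hα'.le _, length_leftPart hα _⟩
  · have key : ∀ n, τ.move B n = σ.move B n := by
      intro n
      induction n using Nat.strong_induction_on with
      | _ n ih =>
        have hleg : BlackLegal β σ (continuedPlay σ β B n) :=
          blackLegal_continuedPlay hβ hβ' fun i hi => by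
            rw [← ih i hi]
            exact hB i
        have h1 := (h _ (by rw [continuedPlay_of_le _ _ _ n.zero_le, hB0]) hleg).1 n
        rw [continuedPlay_of_le _ _ _ le_rfl,
          σ.move_congr (B' := B) fun j hj => continuedPlay_of_le _ _ _ hj] at h1
        rw [hτ, if_pos h1]
    have hB' : BlackLegal β σ B := fun n => by
      rw [← key n]
      exact hB n
    simpa only [key] using (h B hB0 hB').2

/-! ### Countable intersections -/

lemma BlackLegal.toSet_subset_and_length {α β : ℝ} {σ : WhiteStrategy} {B : ℕ → ClosedInterval}
    (hB : BlackLegal β σ B) (hW : WhiteLegal α σ B) (n j : ℕ) :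
    (B (n + j)).toSet ⊆ (B n).toSet ∧ (B (n + j)).length = (α * β) ^ j * (B n).length := by
  induction j with
  | zero => simp
  | succ j ih =>
    refine ⟨((hB (n + j)).1.trans (hW (n + j)).1).trans ih.1, ?_⟩
    rw [← add_assoc, (hB (n + j)).2, (hW (n + j)).2, ih.2]
    ring

/-- Schmidt's intersection principle. The strategy for the `k`-th set is used at the turns
`2 ^ k * (2 * m + 1)`; between two of them the other turns act as a single move of Black, with
`β * (α * β) ^ (2 ^ (k + 1) - 1)` in place of `β`. Turn `0` moves away from the point `1`. -/
theorem isAlphaWinning_iInter {α : ℝ} (hα : 0 < α) (hα' : α < 1) {E : ℕ → Set ℝ}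
    (hE : ∀ k β, 0 < β → β < 1 → ∀ I : ClosedInterval, I.toSet ⊆ Ico 0 1 →
      WinsFrom α β I (E k)) :
    IsAlphaWinning α (⋂ k, E k) := by
  classical
  intro β hβ hβ'
  have hγ : 0 < α * β := mul_pos hα hβ
  have hγ' : α * β < 1 := mul_lt_one_of_nonneg_of_lt_one_left hα.le hα' hβ'.le
  let b : ℕ → ℝ := fun k => β * (α * β) ^ (2 ^ (k + 1) - 1)
  have hb : ∀ k, 0 < b k := fun k => mul_pos hβ (pow_pos hγ _)
  have hb' : ∀ k, b k < 1 := fun k =>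
    mul_lt_one_of_nonneg_of_lt_one_left hβ.le hβ' (pow_le_one₀ hγ.le hγ'.le)
  have hex : ∀ (k : ℕ) (I : ClosedInterval), ∃ σ : WhiteStrategy, (∀ B, WhiteLegal α σ B) ∧
      (I.toSet ⊆ Ico 0 1 → ∀ B : ℕ → ClosedInterval, B 0 = I → BlackLegal (b k) σ B →
        ⋂ n, (σ.move B n).toSet ⊆ E k) := by
    intro k I
    by_cases hI : I.toSet ⊆ Ico 0 1
    · obtain ⟨σ, h1, h2⟩ := hE k (b k) (hb k) (hb' k) I hI
      exact ⟨σ, h1, fun _ => h2⟩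
    · exact ⟨fun n h => (h (Fin.last n)).leftPart α,
        fun B n => ⟨leftPart_subset hα hα'.le _, length_leftPart hα _⟩, fun h => absurd h hI⟩
  choose τ hτ hτE using hex
  let σ : WhiteStrategy := fun n h =>
    -- All indices are at most `n`, so that the reduction modulo `n + 1` in `Fin.ofNat` is void.
    if n = 0 then (h 0).leftPart α else
      τ (padicValNat 2 n) (h (Fin.ofNat (n + 1) (2 ^ padicValNat 2 n)))
        (n / 2 ^ padicValNat 2 n / 2)
        (fun i => h (Fin.ofNat (n + 1) (2 ^ padicValNat 2 n * (2 * i + 1))))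
  have hσ0 : ∀ B, σ.move B 0 = (B 0).leftPart α := fun B => rfl
  have hσ : ∀ B k m, σ.move B (2 ^ k * (2 * m + 1)) =
      (τ k (B (2 ^ k))).move (fun i => B (2 ^ k * (2 * i + 1))) m := by
    intro B k m
    have hpos : 0 < 2 ^ k * (2 * m + 1) := by positivity
    have hk : padicValNat 2 (2 ^ k * (2 * m + 1)) = k := by
      rw [padicValNat.mul (by positivity) (by positivity), padicValNat.prime_pow,
        padicValNat.eq_zero_of_not_dvd (by omega), add_zero]
    have hm : 2 ^ k * (2 * m + 1) / 2 ^ k / 2 = m := by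
      rw [Nat.mul_div_cancel_left _ (by positivity)]
      omega
    -- The index of the auxiliary move is a dependent argument: it is fixed before rewriting.
    have hgen : ∀ n k m, padicValNat 2 n = k → n / 2 ^ k / 2 = m → 0 < n →
        (∀ i ≤ m, 2 ^ k * (2 * i + 1) ≤ n) →
        σ.move B n = (τ k (B (2 ^ k))).move (fun i => B (2 ^ k * (2 * i + 1))) m := by
      rintro n _ _ rfl rfl hn hle
      have h0 := Nat.mod_eq_of_lt (Nat.lt_succ_iff.2 (hle 0 (Nat.zero_le _)))
      simp only [mul_zero, zero_add, mul_one] at h0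
      simp only [WhiteStrategy.move, σ, if_neg hn.ne', Fin.val_ofNat, h0]
      congr 1
      funext i
      rw [Nat.mod_eq_of_lt (Nat.lt_succ_iff.2 (hle i (Nat.lt_succ_iff.1 i.2)))]
    exact hgen _ k m hk hm hpos fun i hi => Nat.mul_le_mul_left _ (by omega)
  have hleg : ∀ B, WhiteLegal α σ B := by
    intro B n
    rcases Nat.eq_zero_or_pos n with rfl | hn
    · rw [hσ0]
      exact ⟨leftPart_subset hα hα'.le _, length_leftPart hα _⟩
    · obtain ⟨k, m', ⟨m, rfl⟩, rfl⟩ := Nat.exists_eq_two_pow_mul_odd hn.ne'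
      rw [hσ]
      exact hτ k _ _ m
  refine ⟨σ, fun B hB0 hB => ⟨hleg B, subset_iInter fun k => ?_⟩⟩
  have hmono := fun n j => (hB.toSet_subset_and_length (hleg B) n j)
  have hI : (B (2 ^ k)).toSet ⊆ Ico 0 1 := by
    obtain ⟨j, hj⟩ : ∃ j, 2 ^ k = 0 + 1 + j :=
      ⟨2 ^ k - 1, by have : 0 < 2 ^ k := by positivity
                     omega⟩
    rw [hj]
    refine (hmono _ j).1.trans ((hB 0).1.trans ?_)
    rw [hσ0]
    have h0 := (Icc_subset_Icc_iff (B 0).left_lt_right.le).1 hB0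
    have h1 : α * (B 0).length < (B 0).length := mul_lt_of_lt_one_left (B 0).length_pos hα'
    intro y hy
    simp only [leftPart, hα, dif_pos, toSet, mem_Icc] at hy
    simp only [ClosedInterval.length] at h1 hy
    exact ⟨h0.1.trans hy.1, by linarith [h0.2, hy.2]⟩
  have hsub : BlackLegal (b k) (τ k (B (2 ^ k))) (fun i => B (2 ^ k * (2 * i + 1))) := by
    intro i
    have hidx : 2 ^ k * (2 * (i + 1) + 1) = 2 ^ k * (2 * i + 1) + 1 + (2 ^ (k + 1) - 1) := by
      have : 0 < 2 ^ (k + 1) := by positivity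
      have h2 : 2 ^ k * (2 * (i + 1) + 1) = 2 ^ k * (2 * i + 1) + 2 ^ (k + 1) := by ring
      omega
    have h1 := hmono (2 ^ k * (2 * i + 1) + 1) (2 ^ (k + 1) - 1)
    have h2 := hB (2 ^ k * (2 * i + 1))
    simp only [← hσ, hidx]
    refine ⟨h1.1.trans h2.1, ?_⟩
    rw [h1.2, h2.2]
    ring
  refine Subset.trans ?_ (hτE k _ hI _ (by simp) hsub)
  refine subset_iInter fun m => ?_
  rw [← hσ]
  exact iInter_subset _ _

/-! ### The avoidance game -/

open Classical in
/-- The potential of a family of obstacles `D l` of scales `c l`, relative to an interval `W` and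
a scale `b`: the obstacles which meet `W` and whose scale is at least `b` are counted with weight
`(c l / b) ^ s`. -/
noncomputable def obstaclePotential {Λ : Type*} (s : ℝ) (c : Λ → ℝ) (D : Λ → Set ℝ) (b : ℝ)
    (W : ClosedInterval) : ENNReal :=
  ∑' l, if (D l ∩ W.toSet).Nonempty ∧ b ≤ c l then ENNReal.ofReal ((c l / b) ^ s) else 0

section Potential

variable {Λ : Type*} {s : ℝ} {c : Λ → ℝ} {D : Λ → Set ℝ}

lemma weight_le_obstaclePotential {b : ℝ} {W : ClosedInterval} {l : Λ}
    (h : (D l ∩ W.toSet).Nonempty) (hb : b ≤ c l) :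
    ENNReal.ofReal ((c l / b) ^ s) ≤ obstaclePotential s c D b W := by
  classical
  refine le_trans ?_ (ENNReal.le_tsum l)
  rw [if_pos ⟨h, hb⟩]

lemma obstaclePotential_le (hs : 0 < s) {b : ℝ} {W : ClosedInterval} {K : ℕ}
    (hK : {l | (D l ∩ W.toSet).Nonempty ∧ b ≤ c l}.encard ≤ K) (hc : ∀ l, c l ≤ 1)
    (hb : 0 < b) :
    obstaclePotential s c D b W ≤ ENNReal.ofReal ((1 / b) ^ s * K) := by
  classical
  set S := {l | (D l ∩ W.toSet).Nonempty ∧ b ≤ c l} with hS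
  calc obstaclePotential s c D b W
      ≤ ∑' l, S.indicator (fun _ => ENNReal.ofReal ((1 / b) ^ s)) l := by
        refine ENNReal.tsum_le_tsum fun l => ?_
        by_cases hl : (D l ∩ W.toSet).Nonempty ∧ b ≤ c l
        · rw [indicator_of_mem (show l ∈ S from hl), if_pos hl]
          have : 0 ≤ c l := hb.le.trans hl.2
          gcongr
          exact hc l
        · rw [indicator_of_notMem (show l ∉ S from hl), if_neg hl]
    _ ≤ ENNReal.ofReal ((1 / b) ^ s * K) := by
        rw [← tsum_subtype, ENNReal.tsum_set_const, mul_comm,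
          ENNReal.ofReal_mul (by positivity), ENNReal.ofReal_natCast]
        gcongr
        exact_mod_cast ENat.toENNReal_le.2 hK

/-- As long as the potential is below `T ^ s`, no relevant obstacle is long enough to meet both
the left and the right part of the interval. -/
lemma obstaclePotential_left_add_right_le {α p T : ℝ} (hs : 0 < s) (hα : 0 < α) (hα' : α ≤ 1 / 4)
    (hp : 0 ≤ p) (hT : 0 < T) (hpT : p < T ^ s)
    (hD : ∀ l, ∀ y ∈ D l, ∀ z ∈ D l, |y - z| * (2 * T) ≤ c l)
    {B : ClosedInterval} (hB : obstaclePotential s c D B.length B ≤ ENNReal.ofReal p) :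
    obstaclePotential s c D B.length (B.leftPart α) +
      obstaclePotential s c D B.length (B.rightPart α) ≤
        obstaclePotential s c D B.length B := by
  classical
  have hb := B.length_pos
  have hL := leftPart_subset hα (by linarith) B
  have hR := rightPart_subset hα (by linarith) B
  unfold obstaclePotential
  rw [← ENNReal.tsum_add]
  refine ENNReal.tsum_le_tsum fun l => ?_
  by_cases hl : B.length ≤ c l
  swap
  · simp [hl]
  by_cases h1 : (D l ∩ (B.leftPart α).toSet).Nonempty
  swap
  · simp only [h1, false_and, if_false, zero_add]
    by_cases h2 : (D l ∩ (B.rightPart α).toSet).Nonempty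
    · rw [if_pos ⟨h2, hl⟩, if_pos ⟨h2.mono (inter_subset_inter_right _ hR), hl⟩]
    · simp [h2]
  by_cases h2 : (D l ∩ (B.rightPart α).toSet).Nonempty
  swap
  · simp only [h2, false_and, if_false, add_zero]
    rw [if_pos ⟨h1, hl⟩, if_pos ⟨h1.mono (inter_subset_inter_right _ hL), hl⟩]
  exfalso
  have h3 := (weight_le_obstaclePotential (s := s)
    (h1.mono (inter_subset_inter_right _ hL)) hl).trans hB
  rw [ENNReal.ofReal_le_ofReal_iff hp] at h3
  have h4 : c l / B.length < T := by
    by_contra! h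
    exact absurd (h3.trans_lt hpT) (not_lt.2 (Real.rpow_le_rpow hT.le h hs.le))
  rw [div_lt_iff₀ hb] at h4
  obtain ⟨y, hyD, hyL⟩ := h1
  obtain ⟨z, hzD, hzR⟩ := h2
  have h5 := hD l y hyD z hzD
  have h6 : |y - z| < B.length / 2 := by
    have : |y - z| * (2 * T) < B.length / 2 * (2 * T) := by linarith
    exact lt_of_mul_lt_mul_right this (by positivity)
  simp only [leftPart, rightPart, hα, dif_pos, toSet, mem_Icc] at hyL hzR
  have h7 : α * B.length ≤ 1 / 4 * B.length := mul_le_mul_of_nonneg_right hα' hb.le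
  have h8 := neg_abs_le (y - z)
  have h9 : B.length = B.right - B.left := rfl
  linarith [hyL.2, hzR.1]

/-- Passing from `B` to an interval `B'` shorter by the factor `γ` multiplies the old weights by
`3 / 2` and adds the obstacles with scale between the two lengths. -/
lemma obstaclePotential_step {γ : ℝ} (hs : 0 < s) (hγ : 0 < γ)
    (hγs : (1 / γ) ^ s = 3 / 2) {K : ℕ} {B W B' : ClosedInterval} (hBW : B'.toSet ⊆ W.toSet)
    (hlen : B'.length = γ * B.length)
    (hK : {l | (D l ∩ B'.toSet).Nonempty ∧ B'.length ≤ c l ∧ c l < B.length}.encard ≤ K) :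
    obstaclePotential s c D B'.length B' ≤
      ENNReal.ofReal (3 / 2) * obstaclePotential s c D B.length W + ENNReal.ofReal (3 / 2 * K) := by
  classical
  have hb := B.length_pos
  have hb' := B'.length_pos
  set S := {l | (D l ∩ B'.toSet).Nonempty ∧ B'.length ≤ c l ∧ c l < B.length} with hS
  have hnew : ∑' l, S.indicator (fun _ => ENNReal.ofReal (3 / 2)) l ≤
      ENNReal.ofReal (3 / 2 * K) := by
    rw [← tsum_subtype, ENNReal.tsum_set_const, mul_comm, ENNReal.ofReal_mul (by norm_num),
      ENNReal.ofReal_natCast]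
    gcongr
    exact_mod_cast ENat.toENNReal_le.2 hK
  refine le_trans ?_ (add_le_add le_rfl hnew)
  unfold obstaclePotential
  rw [← ENNReal.tsum_mul_left, ← ENNReal.tsum_add]
  refine ENNReal.tsum_le_tsum fun l => ?_
  by_cases hl : (D l ∩ B'.toSet).Nonempty ∧ B'.length ≤ c l
  swap
  · rw [if_neg hl]
    exact zero_le
  rw [if_pos hl]
  have hc : 0 < c l := hb'.trans_le hl.2
  have hw : (c l / B'.length) ^ s = 3 / 2 * (c l / B.length) ^ s := by
    rw [hlen, ← hγs, ← Real.mul_rpow (by positivity) (by positivity)]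
    congr 1
    field_simp
  rw [hw, ENNReal.ofReal_mul (by norm_num)]
  rcases le_or_gt B.length (c l) with h | h
  · rw [if_pos ⟨hl.1.mono (inter_subset_inter_right _ hBW), h⟩]
    exact le_self_add
  · have : l ∈ S := ⟨hl.1, hl.2, h⟩
    rw [indicator_of_mem this]
    refine le_trans ?_ le_add_self
    have h1 : (c l / B.length) ^ s ≤ 1 :=
      Real.rpow_le_one (by positivity) ((div_le_one hb).2 h.le) hs.le
    calc ENNReal.ofReal (3 / 2) * ENNReal.ofReal ((c l / B.length) ^ s)
        ≤ ENNReal.ofReal (3 / 2) * ENNReal.ofReal 1 := by gcongr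
      _ = ENNReal.ofReal (3 / 2) := by simp

/-- White avoids every obstacle of a family if boundedly many of them enter at each scale and each
is short compared with its scale: he keeps the potential bounded by choosing, of the left and the
right part of Black's interval, the one with the smaller potential. The weight of an obstacle that
is never avoided would tend to infinity. -/
theorem winsFrom_compl_iUnion {α β p T : ℝ} {K : ℕ} {I : ClosedInterval} (hα : 0 < α)
    (hα' : α ≤ 1 / 4) (hβ : 0 < β) (hβ' : β < 1) (hs : 0 < s)
    (hγs : (1 / (α * β)) ^ s = 3 / 2) (hc : ∀ l, 0 < c l)
    (hK : ∀ B B' : ClosedInterval, B'.length = α * β * B.length →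
      {l | (D l ∩ B'.toSet).Nonempty ∧ B'.length ≤ c l ∧ c l < B.length}.encard ≤ K)
    (hI : obstaclePotential s c D I.length I ≤ ENNReal.ofReal p) (hKp : 6 * K ≤ p)
    (hT : 0 < T) (hpT : p < T ^ s)
    (hD : ∀ l, ∀ y ∈ D l, ∀ z ∈ D l, |y - z| * (2 * T) ≤ c l) :
    WinsFrom α β I (⋃ l, D l)ᶜ := by
  classical
  have hγ : 0 < α * β := mul_pos hα hβ
  have hγ' : α * β < 1 := mul_lt_one_of_nonneg_of_lt_one_left hα.le (by linarith) hβ'.le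
  have hp : 0 ≤ p := le_trans (by positivity) hKp
  let choice : ClosedInterval → ClosedInterval := fun B =>
    if obstaclePotential s c D B.length (B.leftPart α) ≤
      obstaclePotential s c D B.length (B.rightPart α) then B.leftPart α else B.rightPart α
  have hchoice : ∀ B, obstaclePotential s c D B.length B ≤ ENNReal.ofReal p →
      obstaclePotential s c D B.length (choice B) ≤ ENNReal.ofReal (p / 2) := by
    intro B hB
    have h1 := (obstaclePotential_left_add_right_le hs hα hα' hp hT hpT hD hB).trans hB
    have h2 : 2 * obstaclePotential s c D B.length (choice B) ≤ ENNReal.ofReal p := by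
      rw [two_mul]
      refine le_trans ?_ h1
      simp only [choice]
      split_ifs with h
      · exact add_le_add le_rfl h
      · exact add_le_add (not_le.1 h).le le_rfl
    rw [ENNReal.ofReal_div_of_pos two_pos, ENNReal.ofReal_ofNat,
      ENNReal.le_div_iff_mul_le (by simp) (by simp), mul_comm]
    exact h2
  let σ : WhiteStrategy := fun n h => choice (h (Fin.last n))
  have hσ : ∀ B n, σ.move B n = choice (B n) := fun B n => rfl
  have hleg : ∀ B, WhiteLegal α σ B := by
    intro B n
    rw [hσ]
    simp only [choice]
    split_ifs
    · exact ⟨leftPart_subset hα (by linarith) _, length_leftPart hα _⟩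
    · exact ⟨rightPart_subset hα (by linarith) _, length_rightPart hα _⟩
  refine ⟨σ, hleg, fun B hB0 hB => ?_⟩
  have hmono := hB.toSet_subset_and_length (hleg B)
  have hpot : ∀ n, obstaclePotential s c D (B n).length (B n) ≤ ENNReal.ofReal p := by
    intro n
    induction n with
    | zero => rwa [hB0]
    | succ n ih =>
      have h1 : (B (n + 1)).length = α * β * (B n).length := by
        rw [(hB n).2, (hleg B n).2]
        ring
      calc _ ≤ _ := obstaclePotential_step hs hγ hγs (hB n).1 h1 (hK _ _ h1)
        _ ≤ ENNReal.ofReal (3 / 2) * ENNReal.ofReal (p / 2) + ENNReal.ofReal (3 / 2 * K) := by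
          gcongr
          rw [hσ]
          exact hchoice _ ih
        _ = ENNReal.ofReal (3 / 2 * (p / 2) + 3 / 2 * K) := by
          rw [← ENNReal.ofReal_mul (by norm_num), ← ENNReal.ofReal_add (by positivity)
            (by positivity)]
        _ ≤ ENNReal.ofReal p := ENNReal.ofReal_le_ofReal (by linarith)
  intro y hy hyD
  obtain ⟨l, hl⟩ := mem_iUnion.1 hyD
  have hyB : ∀ n, y ∈ (B n).toSet := fun n => (hleg B n).1 (mem_iInter.1 hy n)
  have hlen : ∀ n, (B n).length = (α * β) ^ n * I.length := fun n => by
    have := (hmono 0 n).2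
    rwa [zero_add, hB0] at this
  have htend : Tendsto (fun n => (B n).length) atTop (𝓝 0) := by
    simp only [hlen]
    simpa using (tendsto_pow_atTop_nhds_zero_of_lt_one hγ.le hγ').mul_const I.length
  obtain ⟨n, hn⟩ := (htend.eventually (gt_mem_nhds
    (lt_min (hc l) (div_pos (hc l) hT)))).exists
  have h1 := (weight_le_obstaclePotential (s := s) ⟨y, hl, hyB n⟩
    (hn.trans_le (min_le_left _ _)).le).trans (hpot n)
  rw [ENNReal.ofReal_le_ofReal_iff hp] at h1
  have h2 : T ≤ c l / (B n).length := by
    have := hn.trans_le (min_le_right _ _)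
    rw [lt_div_iff₀ hT] at this
    rw [le_div_iff₀ (B n).length_pos]
    linarith
  exact absurd (h1.trans_lt hpT) (not_lt.2 (Real.rpow_le_rpow hT.le h2 hs.le))

end Potential

/-! ### Cylinders -/

section Cylinder

variable {ι : Type*} {f : ℝ → ℝ} {J : ι → Set ℝ}

lemma cylinder_zero (ω : ℕ → ι) : cylinder f J ω 0 = Ico 0 1 := by
  ext y
  simp [_root_.cylinder]

lemma cylinder_subset_unit (ω : ℕ → ι) (n : ℕ) : cylinder f J ω n ⊆ Ico 0 1 :=
  fun _ h => h.1

lemma cylinder_succ (ω : ℕ → ι) (n : ℕ) :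
    cylinder f J ω (n + 1) = cylinder f J ω n ∩ {y | f^[n] y ∈ J (ω n)} := by
  ext y
  simp only [_root_.cylinder, Nat.forall_lt_succ_right, mem_ofPred_eq, mem_inter_iff, and_assoc]

lemma cylinder_anti (ω : ℕ → ι) {n m : ℕ} (h : n ≤ m) :
    cylinder f J ω m ⊆ cylinder f J ω n :=
  fun _ hy => ⟨hy.1, fun i hi => hy.2 i (hi.trans_le h)⟩

/-- The concatenation of the first `n` letters of `ω` with the word `u`. -/
def concatWord (ω u : ℕ → ι) (n : ℕ) : ℕ → ι := fun i => if i < n then ω i else u (i - n)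

lemma cylinder_concatWord_self (ω u : ℕ → ι) (n : ℕ) :
    cylinder f J (concatWord ω u n) n = cylinder f J ω n := by
  ext y
  refine and_congr_right fun _ => forall₂_congr fun i hi => ?_
  simp [concatWord, hi]

lemma mem_cylinder_concatWord {ω u : ℕ → ι} {n m : ℕ} {y : ℝ} (hy : y ∈ cylinder f J ω n)
    (hu : f^[n] y ∈ cylinder f J u m) : y ∈ cylinder f J (concatWord ω u n) (n + m) := by
  refine ⟨hy.1, fun i hi => ?_⟩
  by_cases h : i < n
  · simpa [concatWord, h] using hy.2 i h
  · have h1 := hu.2 (i - n) (by omega)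
    rw [← Function.iterate_add_apply, Nat.sub_add_cancel (not_lt.1 h)] at h1
    simpa [concatWord, h] using h1

lemma volume_cylinder_ne_top (ω : ℕ → ι) (n : ℕ) : volume (cylinder f J ω n) ≠ ⊤ :=
  measure_ne_top_of_subset (cylinder_subset_unit ω n) (by simp)

lemma volume_real_cylinder_anti (ω : ℕ → ι) {n m : ℕ} (h : n ≤ m) :
    volume.real (cylinder f J ω m) ≤ volume.real (cylinder f J ω n) :=
  measureReal_mono (cylinder_anti ω h) (volume_cylinder_ne_top ω n)

lemma volume_real_cylinder_le_one (ω : ℕ → ι) (n : ℕ) : volume.real (cylinder f J ω n) ≤ 1 := by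
  refine (volume_real_cylinder_anti ω n.zero_le).trans ?_
  simp [cylinder_zero]

namespace IsFullBranchMap

variable (hf : IsFullBranchMap f J)
include hf

lemma iterate_mem_unit {ω : ℕ → ι} {n : ℕ} {y : ℝ} (hy : y ∈ cylinder f J ω n) :
    f^[n] y ∈ Ico (0 : ℝ) 1 := by
  cases n with
  | zero => exact hy.1
  | succ n =>
    rw [Function.iterate_succ_apply']
    exact hf.mapsTo _ (hy.2 n n.lt_succ_self)

lemma cylinder_subset_of_mem {ω ω' : ℕ → ι} {n m : ℕ} (h : n ≤ m) {y : ℝ}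
    (hy : y ∈ cylinder f J ω n) (hy' : y ∈ cylinder f J ω' m) :
    cylinder f J ω' m ⊆ cylinder f J ω n := by
  refine fun z hz => ⟨hz.1, fun i hi => ?_⟩
  have : ω i = ω' i := by
    by_contra hne
    exact disjoint_left.1 (hf.disjoint hne) (hy.2 i hi) (hy'.2 i (hi.trans_le h))
  rw [this]
  exact hz.2 i (hi.trans_le h)

lemma ordConnected_cylinder_and_monotone (ω : ℕ → ι) (n : ℕ) :
    (cylinder f J ω n).OrdConnected ∧
      (MonotoneOn f^[n] (cylinder f J ω n) ∨ AntitoneOn f^[n] (cylinder f J ω n)) := by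
  induction n with
  | zero =>
    rw [cylinder_zero]
    exact ⟨ordConnected_Ico, Or.inl monotoneOn_id⟩
  | succ n ih =>
    obtain ⟨hC, hm⟩ := ih
    have hsub := cylinder_anti (f := f) (J := J) ω n.le_succ
    have hmaps : MapsTo f^[n] (cylinder f J ω (n + 1)) (J (ω n)) :=
      fun y hy => hy.2 n n.lt_succ_self
    refine ⟨⟨fun a ha b hb z hz => ?_⟩, ?_⟩
    · have hzC := hC.out (hsub ha) (hsub hb) hz
      rw [cylinder_succ]
      refine ⟨hzC, ?_⟩
      rcases hm with hm | hm
      · exact (hf.interval _).out (hmaps ha) (hmaps hb)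
          ⟨hm (hsub ha) hzC hz.1, hm hzC (hsub hb) hz.2⟩
      · exact (hf.interval _).out (hmaps hb) (hmaps ha)
          ⟨hm hzC (hsub hb) hz.2, hm (hsub ha) hzC hz.1⟩
    · rw [Function.iterate_succ']
      rcases hm with hm | hm <;> rcases hf.monotone_or_antitone (ω n) with hg | hg
      · exact Or.inl (hg.comp (hm.mono hsub) hmaps)
      · exact Or.inr fun a ha b hb hab =>
          hg (hmaps ha) (hmaps hb) (hm (hsub ha) (hsub hb) hab)
      · exact Or.inr fun a ha b hb hab =>
          hg (hmaps hb) (hmaps ha) (hm (hsub ha) (hsub hb) hab)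
      · exact Or.inl (hg.comp (hm.mono hsub) hmaps)

lemma ordConnected_cylinder (ω : ℕ → ι) (n : ℕ) : (cylinder f J ω n).OrdConnected :=
  (hf.ordConnected_cylinder_and_monotone ω n).1

lemma injOn_iterate_cylinder (ω : ℕ → ι) (n : ℕ) : InjOn f^[n] (cylinder f J ω n) := by
  induction n with
  | zero => exact injOn_id _
  | succ n ih =>
    intro a ha b hb hab
    rw [Function.iterate_succ_apply', Function.iterate_succ_apply'] at hab
    refine ih (cylinder_anti ω n.le_succ ha) (cylinder_anti ω n.le_succ hb) ?_
    have h1 := hf.noncontracting _ _ (ha.2 n n.lt_succ_self) _ (hb.2 n n.lt_succ_self)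
    rw [hab, sub_self, abs_zero] at h1
    exact sub_eq_zero.1 (abs_nonpos_iff.1 h1)

lemma infinite_cylinder (ω : ℕ → ι) (n : ℕ) : (cylinder f J ω n).Infinite := by
  induction n generalizing ω with
  | zero =>
    rw [cylinder_zero]
    exact Ico_infinite one_pos
  | succ n ih =>
    refine Infinite.of_image f (((ih fun i => ω (i + 1)).sdiff (finite_singleton 0)).mono ?_)
    rintro z ⟨hz, hz0⟩
    obtain ⟨y, hy, rfl⟩ := hf.onto (ω 0) ⟨lt_of_le_of_ne hz.1.1 (Ne.symm hz0), hz.1.2⟩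
    refine ⟨y, ⟨hf.subset_unit _ hy, fun i hi => ?_⟩, rfl⟩
    cases i with
    | zero => exact hy
    | succ i =>
      rw [Function.iterate_succ_apply]
      exact hz.2 i (by omega)

lemma volume_real_cylinder_pos (ω : ℕ → ι) (n : ℕ) : 0 < volume.real (cylinder f J ω n) := by
  obtain ⟨a, ha, b, hb, hab⟩ := (hf.infinite_cylinder ω n).nontrivial.exists_lt
  refine lt_of_lt_of_le ?_ (measureReal_mono ((hf.ordConnected_cylinder ω n).out ha hb)
    (volume_cylinder_ne_top ω n))
  simpa [Real.volume_real_Icc] using hab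

/-- Uniform shrinking of cylinders, also relative to the generation-`0` cylinder. -/
lemma exists_volume_real_cylinder_le (hii : CylindersShrink f J) {ε : ℝ} (hε : 0 < ε) :
    ∃ N : ℕ, 0 < N ∧ ∀ ω n, volume.real (cylinder f J ω (n + N)) ≤
      ε * volume.real (cylinder f J ω n) := by
  obtain ⟨g, -, hg, h⟩ := hii
  obtain ⟨m, hm, hm1⟩ := ((hg.eventually (gt_mem_nhds hε)).and (eventually_ge_atTop 1)).exists
  refine ⟨m + 1, m.succ_pos, fun ω n => ?_⟩
  -- One generation is spent on reaching a generation `≥ 1`, where the hypothesis applies.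
  have h1 := h ω (n + 1) m (by omega) hm1
  rw [div_le_iff₀ (hf.volume_real_cylinder_pos ω _)] at h1
  rw [show n + (m + 1) = n + 1 + m by omega]
  refine h1.trans (mul_le_mul hm.le (volume_real_cylinder_anti ω n.le_succ)
    measureReal_nonneg hε.le)

end IsFullBranchMap

/-! ### Counting cylinders of a given size -/

/-- An interval of length at least `d` which meets `[a, b]` covers a length at least `d` of
`[a - d, b + d]`. -/
lemma le_volume_real_inter_Icc {C : Set ℝ} (hC : C.OrdConnected) {a b d : ℝ}
    (hd : 0 ≤ d) (hCd : d ≤ volume.real C) (hCB : (C ∩ Icc a b).Nonempty) :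
    d ≤ volume.real (C ∩ Icc (a - d) (b + d)) := by
  obtain ⟨y, hyC, hy⟩ := hCB
  have hfin : volume (C ∩ Icc (a - d) (b + d)) ≠ ⊤ :=
    measure_ne_top_of_subset inter_subset_right (by simp)
  by_cases h : C ⊆ Icc (a - d) (b + d)
  · rwa [inter_eq_left.2 h]
  obtain ⟨z, hzC, hz⟩ := not_subset.1 h
  rcases lt_or_ge z (a - d) with hza | hza
  · have hsub : Icc (y - d) y ⊆ C ∩ Icc (a - d) (b + d) := fun w hw =>
      ⟨hC.out hzC hyC ⟨by linarith [hw.1, hy.1], hw.2⟩, by linarith [hw.1, hy.1],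
        by linarith [hw.2, hy.2]⟩
    refine le_trans ?_ (measureReal_mono hsub hfin)
    simp [Real.volume_real_Icc]
  · have hzb : b + d < z := by
      by_contra! h1
      exact hz ⟨hza, h1⟩
    have hsub : Icc y (y + d) ⊆ C ∩ Icc (a - d) (b + d) := fun w hw =>
      ⟨hC.out hyC hzC ⟨hw.1, by linarith [hw.2, hy.2]⟩, by linarith [hw.1, hy.1],
        by linarith [hw.2, hy.2]⟩
    refine le_trans ?_ (measureReal_mono hsub hfin)
    simp [Real.volume_real_Icc]

lemma card_le_three_of_disjoint_intervals {Λ : Type*} (t : Finset Λ) (C : Λ → Set ℝ)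
    (B : ClosedInterval) (hC : ∀ l ∈ t, (C l).OrdConnected)
    (hd : (t : Set Λ).PairwiseDisjoint C) (hB : ∀ l ∈ t, (C l ∩ B.toSet).Nonempty)
    (hlen : ∀ l ∈ t, B.length ≤ volume.real (C l)) : t.card ≤ 3 := by
  have hb := B.length_pos
  set S := Icc (B.left - B.length) (B.right + B.length) with hS
  have h1 : ∑ l ∈ t, volume.real (C l ∩ S) ≤ volume.real S := by
    rw [← measureReal_biUnion_finset (hd.mono fun l => inter_subset_left)
      (fun l hl => (hC l hl).measurableSet.inter measurableSet_Icc)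
      (fun l hl => measure_ne_top_of_subset inter_subset_right measure_Icc_lt_top.ne)]
    exact measureReal_mono (iUnion₂_subset fun l _ => inter_subset_right) measure_Icc_lt_top.ne
  have h2 : t.card • B.length ≤ ∑ l ∈ t, volume.real (C l ∩ S) :=
    Finset.card_nsmul_le_sum _ _ _ fun l hl =>
      le_volume_real_inter_Icc (hC l hl) hb.le (hlen l hl) (hB l hl)
  have h3 : volume.real S = 3 * B.length := by
    rw [hS, Real.volume_real_Icc_of_le]
    · simp only [ClosedInterval.length]
      ring
    · linarith [B.left_lt_right]
  rw [h3] at h1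
  rw [nsmul_eq_mul] at h2
  have h4 : (t.card : ℝ) ≤ 3 := le_of_mul_le_mul_right (h2.trans h1) hb
  exact_mod_cast h4

variable (f J) in
/-- A cylinder together with its generation. Different words may define the same cylinder, so the
cylinders are recorded as sets. -/
abbrev GradedCylinder : Type := {p : ℕ × Set ℝ // ∃ ω : ℕ → ι, p.2 = cylinder f J ω p.1}

/-- The number of cylinders which meet an interval `B` and whose length lies between `|B|` and
`2 ^ k * |B|` is bounded independently of `B`. Two of them which belong to the same dyadic range
of lengths and whose generations agree modulo `q` are disjoint, where `q` is such that `q`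
generations halve the length. -/
lemma IsFullBranchMap.exists_encard_gradedCylinder_le (hf : IsFullBranchMap f J)
    (hii : CylindersShrink f J) (k : ℕ) :
    ∃ K : ℕ, ∀ B : ClosedInterval,
      {l : GradedCylinder f J | (l.1.2 ∩ B.toSet).Nonempty ∧ B.length ≤ volume.real l.1.2 ∧
        volume.real l.1.2 < 2 ^ k * B.length}.encard ≤ K := by
  classical
  obtain ⟨q, hq, hshrink⟩ := hf.exists_volume_real_cylinder_le hii one_half_pos
  refine ⟨q * k * 3, fun B => ?_⟩
  have hb := B.length_pos
  set S := {l : GradedCylinder f J | (l.1.2 ∩ B.toSet).Nonempty ∧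
    B.length ≤ volume.real l.1.2 ∧ volume.real l.1.2 < 2 ^ k * B.length} with hS
  by_contra! hlt
  obtain ⟨t', ht'S, ht'⟩ := exists_subset_encard_eq (Order.add_one_le_of_lt hlt)
  have ht'fin : t'.Finite := finite_of_encard_eq_coe (k := q * k * 3 + 1) (by exact_mod_cast ht')
  obtain ⟨t, rfl⟩ := ht'fin.exists_finset_coe
  rw [encard_coe_eq_coe_finsetCard] at ht'
  have htcard : t.card = q * k * 3 + 1 := by exact_mod_cast ht'
  have hdy : ∀ l : GradedCylinder f J, ∃ j : ℕ, l ∈ S → 2 ^ j * B.length ≤ volume.real l.1.2 ∧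
      volume.real l.1.2 < 2 ^ (j + 1) * B.length := by
    intro l
    by_cases hl : l ∈ S
    · obtain ⟨j, hj1, hj2⟩ := exists_nat_pow_near ((one_le_div hb).2 hl.2.1) one_lt_two
      rw [le_div_iff₀ hb] at hj1
      rw [div_lt_iff₀ hb] at hj2
      exact ⟨j, fun _ => ⟨hj1, hj2⟩⟩
    · exact ⟨0, fun h => absurd h hl⟩
  choose j hj using hdy
  obtain ⟨y, -, hy⟩ := Finset.exists_lt_card_fiber_of_mul_lt_card_of_maps_to
    (s := t) (t := Finset.range q ×ˢ Finset.range k) (f := fun l => (l.1.1 % q, j l)) (n := 3)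
    (by
      intro l hl
      have hlS := ht'S hl
      simp only [Finset.mem_product, Finset.mem_range]
      refine ⟨Nat.mod_lt _ hq, ?_⟩
      have h1 := lt_of_mul_lt_mul_right ((hj l hlS).1.trans_lt hlS.2.2) hb.le
      exact (pow_lt_pow_iff_right₀ one_lt_two).1 h1)
    (by simp [htcard])
  refine absurd (card_le_three_of_disjoint_intervals _ (fun l : GradedCylinder f J => l.1.2) B
    ?_ ?_ ?_ ?_) (not_le.2 hy)
  · intro l _
    obtain ⟨ω, hω⟩ := l.2
    simp only [hω]
    exact hf.ordConnected_cylinder ω _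
  · -- A cylinder of a generation higher by at least `q` is too short to lie in the other one.
    have key : ∀ l ∈ t, ∀ l' ∈ t, l.1.1 < l'.1.1 → l.1.1 % q = l'.1.1 % q → j l = j l' →
        Disjoint l.1.2 l'.1.2 := by
      intro l hl l' hl' hgen hmod hjj
      obtain ⟨ω, hω⟩ := l.2
      obtain ⟨ω', hω'⟩ := l'.2
      have hle : l.1.1 + q ≤ l'.1.1 := by
        obtain ⟨d, hd⟩ := (Nat.modEq_iff_dvd' hgen.le).1 hmod
        rcases d with _ | d
        · omega
        · have : q ≤ q * (d + 1) := Nat.le_mul_of_pos_right _ d.succ_pos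
          omega
      rw [disjoint_left]
      intro z hz hz'
      have h1 := (hj l (ht'S hl)).2
      have h2 := (hj l' (ht'S hl')).1
      rw [hω] at hz h1
      rw [hω'] at hz' h2
      have hsub := hf.cylinder_subset_of_mem hgen.le hz hz'
      have hsub' := hf.cylinder_subset_of_mem le_rfl (cylinder_anti ω' hgen.le hz') hz
      have h3 : cylinder f J ω' l.1.1 = cylinder f J ω l.1.1 :=
        Subset.antisymm (hf.cylinder_subset_of_mem le_rfl hz (cylinder_anti ω' hgen.le hz')) hsub'
      have h4 := (volume_real_cylinder_anti (f := f) (J := J) ω' hle).trans (hshrink ω' l.1.1)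
      rw [h3] at h4
      rw [hjj, pow_succ] at h1
      linarith
    intro l hl l' hl' hne
    simp only [Finset.coe_filter, mem_ofPred_eq, Prod.ext_iff] at hl hl'
    obtain ⟨hl, hl1, hl2⟩ := hl
    obtain ⟨hl', hl'1, hl'2⟩ := hl'
    rcases lt_trichotomy l.1.1 l'.1.1 with h | h | h
    · exact key l hl l' hl' h (by simp [hl1, hl'1]) (by simp [hl2, hl'2])
    · change Disjoint l.1.2 l'.1.2
      obtain ⟨ω, hω⟩ := l.2
      obtain ⟨ω', hω'⟩ := l'.2
      rw [disjoint_left]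
      intro z hz hz'
      refine hne (Subtype.ext (Prod.ext h ?_))
      rw [hω] at hz
      rw [hω', ← h] at hz'
      rw [hω, hω', ← h]
      exact Subset.antisymm (hf.cylinder_subset_of_mem le_rfl hz' hz)
        (hf.cylinder_subset_of_mem le_rfl hz hz')
    · exact (key l' hl' l hl h (by simp [hl1, hl'1]) (by simp [hl2, hl'2])).symm
  · exact fun l hl => (ht'S (Finset.mem_filter.1 hl).1).1
  · exact fun l hl => (ht'S (Finset.mem_filter.1 hl).1).2.1

end Cylinder

/-! ### Consequences of the entry game -/

section Entry

variable {ι : Type*} {f : ℝ → ℝ} {J : ι → Set ℝ}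

/-- Generation-`k` cylinders are dense: a legal play that starts at `I` leads into one of them. -/
lemma CanEnterCylinders.exists_inter_nonempty {α₀ : ℝ} (hi : CanEnterCylinders f J α₀) (k : ℕ)
    {I : ClosedInterval} (hI : I.toSet ⊆ Ico 0 1) :
    ∃ ω : ℕ → ι, (cylinder f J ω k ∩ I.toSet).Nonempty := by
  obtain ⟨σ, hσ⟩ := hi k I hI (1 / 2) (by norm_num) (by norm_num)
  set B := continuedPlay σ (1 / 2) (fun _ => I) 0
  have hB0 : B 0 = I := continuedPlay_of_le _ _ _ le_rfl
  have hB : BlackLegal (1 / 2) σ B :=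
    blackLegal_continuedPlay (by norm_num) (by norm_num) fun i hi => absurd hi i.not_lt_zero
  obtain ⟨hW, j, ω, hj⟩ := hσ B hB0 hB
  have hmem : (σ.move B j).left ∈ (σ.move B j).toSet :=
    left_mem_Icc.2 (σ.move B j).left_lt_right.le
  refine ⟨ω, _, hj hmem, ?_⟩
  have h1 := (hB.toSet_subset_and_length hW 0 j).1
  rw [zero_add, hB0] at h1
  exact h1 ((hW j).1 hmem)

/-- White keeps winning the entry game with a smaller parameter `α ≤ α₀`: he chooses part of the
interval that he would have chosen for `α₀`, and counts the loss as part of Black's next move. -/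
lemma CanEnterCylinders.winsFrom {α₀ α β : ℝ} (hi : CanEnterCylinders f J α₀) (hα : 0 < α)
    (hαα₀ : α ≤ α₀) (hα₀' : α₀ < 1) (hβ : 0 < β) (hβ' : β < 1) (k : ℕ)
    {I : ClosedInterval} (hI : I.toSet ⊆ Ico 0 1) :
    WinsFrom α β I (⋃ ω : ℕ → ι, cylinder f J ω k) := by
  have hα₀ : 0 < α₀ := hα.trans_le hαα₀
  have ht : 0 < α / α₀ := div_pos hα hα₀
  have ht' : α / α₀ ≤ 1 := (div_le_one hα₀).2 hαα₀
  obtain ⟨σ, hσ⟩ := hi k I hI (β * (α / α₀)) (mul_pos hβ ht)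
    (mul_lt_one_of_nonneg_of_lt_one_left hβ.le hβ' ht')
  let τ : WhiteStrategy := fun n h => (σ n h).leftPart (α / α₀)
  have hτ : ∀ B n, τ.move B n = (σ.move B n).leftPart (α / α₀) := fun B n => rfl
  refine winsFrom_of_legal hα (hαα₀.trans_lt hα₀') hβ hβ' (σ := τ) fun B hB0 hB => ?_
  have hB' : BlackLegal (β * (α / α₀)) σ B := fun n => by
    have h := hB n
    rw [hτ, length_leftPart ht] at h
    exact ⟨h.1.trans (leftPart_subset ht ht' _), h.2.trans (mul_assoc _ _ _).symm⟩
  obtain ⟨hW, j, ω, hj⟩ := hσ B hB0 hB'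
  refine ⟨fun n => ?_, fun y hy => mem_iUnion.2 ⟨ω, hj ?_⟩⟩
  · rw [hτ, length_leftPart ht, (hW n).2]
    refine ⟨(leftPart_subset ht ht' _).trans (hW n).1, ?_⟩
    field_simp
  · have h := mem_iInter.1 hy j
    rw [hτ] at h
    exact leftPart_subset ht ht' _ h

lemma hasExpansion_of_mem_iInter {y : ℝ} (hy : y ∈ ⋂ k, ⋃ ω : ℕ → ι, cylinder f J ω k) :
    HasExpansion f J y := by
  rw [mem_iInter] at hy
  obtain ⟨ω, hω⟩ := mem_iUnion.1 (hy 0)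
  refine ⟨hω.1, fun n => ?_⟩
  obtain ⟨ω, hω⟩ := mem_iUnion.1 (hy (n + 1))
  exact ⟨ω n, hω.2 n n.lt_succ_self⟩

lemma HasExpansion.exists_mem_cylinder {y : ℝ} (hy : HasExpansion f J y) :
    ∃ ω : ℕ → ι, ∀ n, y ∈ cylinder f J ω n := by
  choose ω hω using hy.2
  exact ⟨ω, fun n => ⟨hy.1, fun i _ => hω i⟩⟩

/-! ### One-sided neighbourhoods inside cylinders -/

lemma Ioo_subset_cylinder_of_disjoint {α₀ : ℝ} (hi : CanEnterCylinders f J α₀) (n : ℕ) {a b : ℝ}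
    (hab : a < b) (hunit : Ioo a b ⊆ Ico 0 1)
    (hdisj : Disjoint (Ioo a b) (cylinderEndpoints f J n)) :
    ∃ ω : ℕ → ι, Ioo a b ⊆ cylinder f J ω n := by
  let I : ClosedInterval := ⟨(2 * a + b) / 3, (a + 2 * b) / 3, by linarith⟩
  have hI : I.toSet ⊆ Ioo a b := fun y hy =>
    ⟨lt_of_lt_of_le (show a < (2 * a + b) / 3 by linarith) hy.1,
      lt_of_le_of_lt hy.2 (show (a + 2 * b) / 3 < b by linarith)⟩
  obtain ⟨ω, y, hyC, hyI⟩ := hi.exists_inter_nonempty n (hI.trans hunit)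
  refine ⟨ω, ?_⟩
  set C := cylinder f J ω n
  have hfr : ∀ z ∈ Ioo a b, z ∉ frontier C := fun z hz hzC =>
    disjoint_left.1 hdisj hz (mem_iUnion.2 ⟨ω, hzC⟩)
  have hcov : Ioo a b ⊆ interior C ∪ (closure C)ᶜ := by
    intro z hz
    by_cases h : z ∈ closure C
    · left
      by_contra h'
      exact hfr z hz ⟨h, h'⟩
    · exact Or.inr h
  have hyint : y ∈ interior C := by
    rcases hcov (hI hyI) with h | h
    · exact h
    · exact absurd (subset_closure hyC) h
  have := isPreconnected_Ioo.subset_left_of_subset_union isOpen_interior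
    isClosed_closure.isOpen_compl
    (disjoint_compl_right.mono_left (interior_subset.trans subset_closure)) hcov ⟨y, hI hyI, hyint⟩
  exact this.trans interior_subset

/-- A point of `[0,1)` at which the endpoints of generation-`n` cylinders do not accumulate has
neighbourhoods on either side which lie in a single generation-`n` cylinder. -/
lemma exists_sides_subset_cylinder {α₀ : ℝ} (hi : CanEnterCylinders f J α₀) (n : ℕ) {x : ℝ}
    (hx : HasExpansion f J x) (hacc : ¬ AccPt x (𝓟 (cylinderEndpoints f J n))) :
    ∃ δ > 0, ∃ u v : ℕ → ι, Ioo (x - δ) x ∩ Ico 0 1 ⊆ cylinder f J u n ∧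
      Ioo x (x + δ) ∩ Ico 0 1 ⊆ cylinder f J v n := by
  rw [accPt_iff_nhds] at hacc
  push Not at hacc
  obtain ⟨U, hU, hUx⟩ := hacc
  obtain ⟨δ', hδ', hball'⟩ := Metric.mem_nhds_iff.1 hU
  rw [Real.ball_eq_Ioo] at hball'
  -- The left neighbourhood is kept inside `[0,1)`, unless `x = 0` and there is nothing to show.
  obtain ⟨δ, hδ, hδδ', hδx⟩ : ∃ δ > 0, δ ≤ δ' ∧ (0 = x ∨ δ ≤ x) := by
    rcases hx.1.1.eq_or_lt with h0 | h0
    · exact ⟨δ', hδ', le_rfl, Or.inl h0⟩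
    · exact ⟨min δ' x, lt_min hδ' h0, min_le_left _ _, Or.inr (min_le_right _ _)⟩
  have hball : Ioo (x - δ) (x + δ) ⊆ U :=
    (Ioo_subset_Ioo (by linarith) (by linarith)).trans hball'
  obtain ⟨ω, -⟩ := hx.exists_mem_cylinder
  have hleft : ∃ u : ℕ → ι, Ioo (x - δ) x ∩ Ico 0 1 ⊆ cylinder f J u n := by
    rcases hδx with h0 | h0
    · exact ⟨ω, fun z hz => absurd hz.2.1 (by linarith [hz.1.2])⟩
    · obtain ⟨u, hu⟩ := Ioo_subset_cylinder_of_disjoint hi n (a := x - δ) (b := x)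
        (by linarith)
        (fun z hz => ⟨by linarith [hz.1], hz.2.trans hx.1.2⟩)
        (disjoint_left.2 fun z hz hzE =>
          hz.2.ne (hUx z ⟨hball ⟨hz.1, by linarith [hz.2]⟩, hzE⟩))
      exact ⟨u, fun z hz => hu hz.1⟩
  have hright : ∃ v : ℕ → ι, Ioo x (x + δ) ∩ Ico 0 1 ⊆ cylinder f J v n := by
    obtain ⟨v, hv⟩ := Ioo_subset_cylinder_of_disjoint hi n (a := x) (b := min 1 (x + δ))
      (lt_min hx.1.2 (by linarith))
      (fun z hz => ⟨hx.1.1.trans hz.1.le, hz.2.trans_le (min_le_left _ _)⟩)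
      (disjoint_left.2 fun z hz hzE =>
        hz.1.ne' (hUx z ⟨hball ⟨by linarith [hz.1], hz.2.trans_le (min_le_right _ _)⟩, hzE⟩))
    exact ⟨v, fun z hz => hv ⟨hz.1.1, lt_min hz.2.2 hz.1.2⟩⟩
  obtain ⟨u, hu⟩ := hleft
  obtain ⟨v, hv⟩ := hright
  exact ⟨δ, hδ, u, v, hu, hv⟩

end Entry

/-! ### Obstacles -/

section Obstacle

variable {ι : Type*} {f : ℝ → ℝ} {J : ι → Set ℝ}

/-- The points of a cylinder of generation `n` whose `n`-th iterate lies in `U`. -/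
def cylinderObstacle (U : Set ℝ) (l : GradedCylinder f J) : Set ℝ :=
  {y | y ∈ l.1.2 ∧ f^[l.1.1] y ∈ U}

/-- If the punctured neighbourhood of `x` lies in two cylinders of generation `N`, then an obstacle
in a cylinder `C` of generation `n` consists of parts of two cylinders of generation `n + N` inside
`C` and of at most one further point. -/
lemma IsFullBranchMap.abs_sub_le_of_mem_obstacle (hf : IsFullBranchMap f J) {N : ℕ} {ε x δ : ℝ}
    (hN : ∀ ω n, volume.real (cylinder f J ω (n + N)) ≤ ε * volume.real (cylinder f J ω n))
    {u v : ℕ → ι} (hu : Ioo (x - δ) x ∩ Ico 0 1 ⊆ cylinder f J u N)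
    (hv : Ioo x (x + δ) ∩ Ico 0 1 ⊆ cylinder f J v N) (l : GradedCylinder f J) :
    ∀ y ∈ cylinderObstacle (Ioo (x - δ) (x + δ)) l,
      ∀ z ∈ cylinderObstacle (Ioo (x - δ) (x + δ)) l,
        |y - z| ≤ 2 * ε * volume.real l.1.2 := by
  obtain ⟨⟨n, C⟩, ω, hC⟩ := l
  dsimp only at hC
  subst hC
  intro y hy z hz
  wlog hyz : y ≤ z generalizing y z
  · rw [abs_sub_comm]
    exact this z hz y hy (le_of_not_ge hyz)
  obtain ⟨hord, hmon⟩ := hf.ordConnected_cylinder_and_monotone ω n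
  obtain ⟨hyC, hyU⟩ := hy
  obtain ⟨hzC, hzU⟩ := hz
  dsimp only at hyC hyU hzC hzU ⊢
  set P := cylinder f J ω n ∩ f^[n] ⁻¹' {x}
  have hcov : Icc y z ⊆ (cylinder f J (concatWord ω u n) (n + N) ∪
      cylinder f J (concatWord ω v n) (n + N)) ∪ P := by
    intro w hw
    have hwC := hord.out hyC hzC hw
    have hwU : f^[n] w ∈ Ioo (x - δ) (x + δ) := by
      rcases hmon with h | h
      · exact ordConnected_Ioo.out hyU hzU ⟨h hyC hwC hw.1, h hwC hzC hw.2⟩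
      · exact ordConnected_Ioo.out hzU hyU ⟨h hwC hzC hw.2, h hyC hwC hw.1⟩
    have hw1 := hf.iterate_mem_unit hwC
    rcases lt_trichotomy (f^[n] w) x with h | h | h
    · exact Or.inl (Or.inl (mem_cylinder_concatWord hwC (hu ⟨⟨hwU.1, h⟩, hw1⟩)))
    · exact Or.inr ⟨hwC, h⟩
    · exact Or.inl (Or.inr (mem_cylinder_concatWord hwC (hv ⟨⟨h, hwU.2⟩, hw1⟩)))
  have hP : volume.real P = 0 := by
    have : P.Subsingleton := fun a ha b hb =>
      hf.injOn_iterate_cylinder ω n ha.1 hb.1 (ha.2.trans hb.2.symm)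
    simp [measureReal_def, this.measure_zero]
  have hfin : volume ((cylinder f J (concatWord ω u n) (n + N) ∪
      cylinder f J (concatWord ω v n) (n + N)) ∪ P) ≠ ⊤ :=
    measure_ne_top_of_subset (union_subset (union_subset (cylinder_subset_unit _ _)
      (cylinder_subset_unit _ _)) (inter_subset_left.trans (cylinder_subset_unit _ _))) (by simp)
  have h1 := (measureReal_mono hcov hfin).trans (measureReal_union_le _ _)
  have h2 := measureReal_union_le (μ := volume) (cylinder f J (concatWord ω u n) (n + N))
    (cylinder f J (concatWord ω v n) (n + N))
  have h3 := hN (concatWord ω u n) n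
  have h4 := hN (concatWord ω v n) n
  rw [cylinder_concatWord_self] at h3 h4
  rw [Real.volume_real_Icc_of_le hyz, hP] at h1
  rw [abs_sub_comm, abs_of_nonneg (sub_nonneg.2 hyz)]
  linarith

lemma not_mem_closure_orbit {x y : ℝ} {U : Set ℝ} (hU : U ∈ 𝓝 x) (hy : HasExpansion f J y)
    (h : y ∈ (⋃ l : GradedCylinder f J, cylinderObstacle U l)ᶜ) :
    x ∉ closure (range fun n : ℕ => f^[n] y) := by
  obtain ⟨ω, hω⟩ := hy.exists_mem_cylinder
  rw [mem_closure_iff_nhds]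
  intro hcl
  obtain ⟨-, hzU, n, rfl⟩ := hcl U hU
  exact h (mem_iUnion.2 ⟨⟨(n, cylinder f J ω n), ω, rfl⟩, hω n, hzU⟩)

/-- From any interval, White can keep the orbit of the outcome away from `x`. -/
lemma IsFullBranchMap.winsFrom_avoid (hf : IsFullBranchMap f J) {α₀ α β : ℝ}
    (hi : CanEnterCylinders f J α₀) (hii : CylindersShrink f J) (hα : 0 < α) (hα' : α ≤ 1 / 4)
    (hβ : 0 < β) (hβ' : β < 1) {x : ℝ} (hx : HasExpansion f J x)
    (hacc : ∀ n : ℕ, ¬ AccPt x (𝓟 (cylinderEndpoints f J n))) (I : ClosedInterval) :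
    WinsFrom α β I {y | HasExpansion f J y → x ∉ closure (range fun n : ℕ => f^[n] y)} := by
  have hγ : 0 < α * β := mul_pos hα hβ
  have hγ' : α * β < 1 := mul_lt_one_of_nonneg_of_lt_one_left hα.le (by linarith) hβ'.le
  have hlog : 0 < Real.log (1 / (α * β)) := Real.log_pos ((one_lt_div hγ).2 hγ')
  -- The exponent for which the weights grow by the factor `3 / 2` in each turn.
  obtain ⟨s, hs, hγs⟩ : ∃ s : ℝ, 0 < s ∧ (1 / (α * β)) ^ s = 3 / 2 := by
    refine ⟨Real.log (3 / 2) / Real.log (1 / (α * β)),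
      div_pos (Real.log_pos (by norm_num)) hlog, ?_⟩
    rw [Real.rpow_def_of_pos (by positivity), mul_div_cancel₀ _ hlog.ne',
      Real.exp_log (by norm_num)]
  obtain ⟨k, hk⟩ := pow_unbounded_of_one_lt (1 / (α * β)) one_lt_two
  obtain ⟨K, hK⟩ := hf.exists_encard_gradedCylinder_le hii k
  have hb := I.length_pos
  obtain ⟨k₀, hk₀⟩ := pow_unbounded_of_one_lt (1 / I.length) one_lt_two
  obtain ⟨K₀, hK₀⟩ := hf.exists_encard_gradedCylinder_le hii k₀
  set p : ℝ := max (6 * K) ((1 / I.length) ^ s * K₀) with hp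
  obtain ⟨T, hpT, hT⟩ := (((tendsto_rpow_atTop hs).eventually_gt_atTop p).and
    (eventually_gt_atTop 0)).exists
  obtain ⟨N, -, hN⟩ := hf.exists_volume_real_cylinder_le hii
    (show 0 < 1 / (4 * T) by positivity)
  obtain ⟨δ, hδ, u, v, hu, hv⟩ := exists_sides_subset_cylinder hi N hx (hacc N)
  have hsub : ∀ U (l : GradedCylinder f J), cylinderObstacle U l ⊆ l.1.2 := fun U l _ h => h.1
  have hwin : WinsFrom α β I
      (⋃ l : GradedCylinder f J, cylinderObstacle (Ioo (x - δ) (x + δ)) l)ᶜ := by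
    refine winsFrom_compl_iUnion (c := fun l => volume.real l.1.2) (p := p) (T := T) (K := K)
      hα hα' hβ hβ' hs hγs ?_ ?_ ?_ (le_max_left _ _) hT hpT ?_
    · intro l
      obtain ⟨ω, hω⟩ := l.2
      simp only [hω]
      exact hf.volume_real_cylinder_pos ω _
    · intro B B' hlen
      refine (encard_le_encard ?_).trans (hK B')
      rintro l ⟨h1, h2, h3⟩
      refine ⟨h1.mono (inter_subset_inter_left _ (hsub _ l)), h2, h3.trans_le ?_⟩
      rw [hlen, ← mul_assoc]
      rw [div_lt_iff₀ hγ] at hk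
      exact le_mul_of_one_le_left B.length_pos.le hk.le
    · refine (obstaclePotential_le hs ((encard_le_encard ?_).trans (hK₀ I)) ?_ hb).trans
        (ENNReal.ofReal_le_ofReal (le_max_right _ _))
      · rintro l ⟨h1, h2⟩
        refine ⟨h1.mono (inter_subset_inter_left _ (hsub _ l)), h2, ?_⟩
        obtain ⟨ω, hω⟩ := l.2
        rw [div_lt_iff₀ hb] at hk₀
        rw [hω]
        exact (volume_real_cylinder_le_one ω _).trans_lt hk₀
      · intro l
        obtain ⟨ω, hω⟩ := l.2
        simp only [hω]
        exact volume_real_cylinder_le_one ω _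
    · intro l y hy z hz
      have h1 := hf.abs_sub_le_of_mem_obstacle hN hu hv l y hy z hz
      calc |y - z| * (2 * T) ≤ 2 * (1 / (4 * T)) * volume.real l.1.2 * (2 * T) := by gcongr
        _ = volume.real l.1.2 := by
          field_simp
          norm_num
  obtain ⟨σ, hσ, hσ'⟩ := hwin
  exact ⟨σ, hσ, fun B hB0 hB y hy hexp =>
    not_mem_closure_orbit (Ioo_mem_nhds (by linarith) (by linarith)) hexp (hσ' B hB0 hB hy)⟩

end Obstacle

theorem mainTheorem1 {ι : Type*} [Countable ι] (f : ℝ → ℝ) (J : ι → Set ℝ)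
    (hf : IsFullBranchMap f J)
    (α₀ : ℝ) (hα₀ : 0 < α₀) (hα₀' : α₀ < 1)
    (hi : CanEnterCylinders f J α₀)
    (hii : CylindersShrink f J)
    (x : ℝ) (hx : HasExpansion f J x)
    (hacc : ∀ n : ℕ, ¬ AccPt x (𝓟 (cylinderEndpoints f J n))) :
    IsAlphaWinning (min α₀ (1 / 4)) (orbitAvoidingSet f J x) := by
  have hα : 0 < min α₀ (1 / 4) := lt_min hα₀ (by norm_num)
  have hα' : min α₀ (1 / 4) < 1 := (min_le_left _ _).trans_lt hα₀'
  -- Index `0` stands for the avoidance game, index `k + 1` for entering generation `k`.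
  let E : ℕ → Set ℝ := fun k => Nat.casesOn k
    {y | HasExpansion f J y → x ∉ closure (range fun n : ℕ => f^[n] y)}
    (fun k => ⋃ ω : ℕ → ι, cylinder f J ω k)
  have hE : ⋂ k, E k ⊆ orbitAvoidingSet f J x := by
    intro y hy
    rw [mem_iInter] at hy
    have hexp : HasExpansion f J y :=
      hasExpansion_of_mem_iInter (mem_iInter.2 fun k => hy (k + 1))
    exact ⟨hexp, hy 0 hexp⟩
  intro β hβ hβ'
  obtain ⟨σ, hσ⟩ := isAlphaWinning_iInter hα hα' (E := E) (fun k β hβ hβ' I hI => by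
    cases k with
    | zero => exact hf.winsFrom_avoid hi hii hα (min_le_right _ _) hβ hβ' hx hacc I
    | succ k => exact hi.winsFrom hα (min_le_left _ _) hα₀' hβ hβ' k hI) β hβ hβ'
  exact ⟨σ, fun B hB0 hB => ⟨(hσ B hB0 hB).1, (hσ B hB0 hB).2.trans hE⟩⟩
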